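/- Let $p$ be an odd prime, let $r\ge 1$, let $\mathbb K$ be a field of order $p^r$ and let $G=\operatorname{SL}_2(\mathbb K)=\operatorname{SL}_2(p^r)$. Let $V_{p-1}(p^r)$ be the space of homogeneous polynomials of degree $p-1$ in $\mathbb K[x,y]$, on which $G$ acts on the right by the substitutions $x\cdot g=ax+by$, $y\cdot g=cx+dy$ for $g=\left(\begin{smallmatrix}a&b\\c&d\end{smallmatrix}\right)$, regarded as an $\mathbb F_pG$-module (of dimension $pr$ over $\mathbb F_p$). An $\mathbb F_pG$-module $V$ of dimension $n$, afforded by $\theta:G\to\operatorname{GL}_n(\mathbb F_p)$ with respect to some basis, *lifts to* $\mathbb Z/p^s\mathbb Z$ if there is a homomorphism $\widehat\theta:G\to\operatorname{GL}_n(\mathbb Z/p^s\mathbb Z)$ whose entrywise reduction modulo $p$ is $\theta$. It *lifts to* $\mathbb Q_p$ if there are a finite-dimensional $\mathbb Q_pG$-module $E$ and a $G$-stable $\mathbb Z_p$-lattice $L\subset E$ such that $L/pL\cong V$ as $\mathbb F_pG$-modules. Then $V_{p-1}(p^r)$ lifts to $\mathbb Z/p^2\mathbb Z$ if and only if $r=1$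 (in particular, $V_2(9)$ does not lift to $\mathbb Z/9\mathbb Z$). Moreover, the Steinberg module $V_{p-1}(p)$ lifts to $\mathbb Q_p$. -/

import Mathlib

open MvPolynomial Matrix

/-- The substitution `x ↦ a x + b y`, `y ↦ c x + d y` on `K[x, y]` attached to a `2 × 2` matrix
`!![a, b; c, d]`; here `x = X 0` and `y = X 1`. -/
noncomputable def polySubst {K : Type*} [CommRing K] (g : Matrix (Fin 2) (Fin 2) K) :
    MvPolynomial (Fin 2) K →ₐ[K] MvPolynomial (Fin 2) K :=
  aeval (fun i => C (g i 0) * X 0 + C (g i 1) * X 1)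

theorem polySubst_one {K : Type*} [CommRing K] :
    polySubst (1 : Matrix (Fin 2) (Fin 2) K) = AlgHom.id K _ := by
  apply MvPolynomial.algHom_ext
  intro i
  fin_cases i <;> simp [polySubst]

theorem polySubst_mul {K : Type*} [CommRing K] (g h : Matrix (Fin 2) (Fin 2) K) :
    polySubst (g * h) = (polySubst h).comp (polySubst g) := by
  apply MvPolynomial.algHom_ext
  intro i
  simp [polySubst, Matrix.mul_apply, Fin.sum_univ_two, algHom_C]
  ring

theorem polySubst_mem {K : Type*} [CommRing K] (g : Matrix (Fin 2) (Fin 2) K) (n : ℕ)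
    {f : MvPolynomial (Fin 2) K} (hf : f ∈ homogeneousSubmodule (Fin 2) K n) :
    polySubst g f ∈ homogeneousSubmodule (Fin 2) K n := by
  have hg : ∀ i : Fin 2,
      (C (g i 0) * X 0 + C (g i 1) * X 1 : MvPolynomial (Fin 2) K).IsHomogeneous 1 := by
    intro i
    refine IsHomogeneous.add ?_ ?_
    · simpa using (isHomogeneous_C (Fin 2) (g i 0)).mul (isHomogeneous_X K (0 : Fin 2))
    · simpa using (isHomogeneous_C (Fin 2) (g i 1)).mul (isHomogeneous_X K (1 : Fin 2))
  have h := IsHomogeneous.aeval ((mem_homogeneousSubmodule n f).1 hf) _ hg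
  rw [one_mul] at h
  exact (mem_homogeneousSubmodule n _).2 h

/-- The module `V_n` of `SL₂(K)`: homogeneous polynomials of degree `n` in `K[x, y]`, regarded as
a representation over a base ring `k` of `K` (below, the prime field). The right action
`x · g = a x + b y`, `y · g = c x + d y` is written as a left action through
`g • f = f · g⁻¹`. -/
noncomputable def homPolyRep (k K : Type*) [CommRing k] [CommRing K] [Algebra k K] (n : ℕ) :
    Representation k (Matrix.SpecialLinearGroup (Fin 2) K) (homogeneousSubmodule (Fin 2) K n) where
  toFun g := ((polySubst (g⁻¹ : Matrix.SpecialLinearGroup (Fin 2) K)).toLinearMap.restrict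
    (fun _ hf => polySubst_mem _ n hf)).restrictScalars k
  map_one' := by
    ext f : 2
    simp [polySubst_one]
  map_mul' g h := by
    ext f : 2
    have e : (((g * h)⁻¹ : Matrix.SpecialLinearGroup (Fin 2) K) : Matrix (Fin 2) (Fin 2) K)
        = (h⁻¹ : Matrix.SpecialLinearGroup (Fin 2) K) * (g⁻¹ : Matrix.SpecialLinearGroup (Fin 2) K) := by
      rw [_root_.mul_inv_rev, Matrix.SpecialLinearGroup.coe_mul]
    change polySubst ((g * h)⁻¹ : Matrix.SpecialLinearGroup (Fin 2) K) f.1 =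
      polySubst (g⁻¹ : Matrix.SpecialLinearGroup (Fin 2) K)
        (polySubst (h⁻¹ : Matrix.SpecialLinearGroup (Fin 2) K) f.1)
    rw [e, polySubst_mul, AlgHom.comp_apply]

/-- A finite-dimensional representation of `G` over `ZMod p` lifts to `ZMod (p ^ s)` if, for some
basis, the corresponding homomorphism `G → GL_n(ZMod p)` is the entrywise reduction of a
homomorphism `G → GL_n(ZMod (p ^ s))`. -/
def LiftsToZModPow {p : ℕ} {G V : Type*} [Group G] [AddCommGroup V] [Module (ZMod p) V]
    (ρ : Representation (ZMod p) G V) (s : ℕ) (hs : s ≠ 0) : Prop :=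
  ∃ (n : ℕ) (b : Module.Basis (Fin n) (ZMod p) V) (θ : G →* GL (Fin n) (ZMod (p ^ s))),
    ∀ g : G, (θ g).1.map (ZMod.castHom (dvd_pow_self p hs) (ZMod p)) =
      LinearMap.toMatrix b b (ρ g)

/-- A representation `ρ` of `G` over `ZMod p` lifts to `ℚ_[p]` if there is a finite-dimensional
representation `σ` of `G` over `ℚ_[p]` and a `G`-stable `ℤ_[p]`-lattice `L` in it with `L / p L`
isomorphic to `ρ`. An additive `G`-equivariant isomorphism is automatically linear over the
prime field. -/
def LiftsToPadic {p : ℕ} [Fact p.Prime] {G V : Type*} [Group G] [AddCommGroup V]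
    [Module (ZMod p) V] (ρ : Representation (ZMod p) G V) : Prop :=
  ∃ (n : ℕ) (σ : Representation ℚ_[p] G (Fin n → ℚ_[p]))
    (L : Submodule ℤ_[p] (Fin n → ℚ_[p])) (_ : Submodule.IsLattice ℚ_[p] L)
    (hL : ∀ (g : G) (v : L), σ g v.1 ∈ L)
    (e : (L ⧸ (Ideal.span {(p : ℤ_[p])} • ⊤ : Submodule ℤ_[p] L)) ≃+ V),
    ∀ (g : G) (v : L),
      e (Submodule.Quotient.mk ⟨σ g v.1, hL g v⟩) = ρ g (e (Submodule.Quotient.mk v))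

/-! The key point is a rigidity of pairs of commuting automorphisms `A`, `B` of order `p` of a free
module `M` over `ℤ / p²`, for odd `p`: if they have the same fixed vectors in `p M ≅ M / p M`, then
their norms `N_A = ∑ Aⁱ` and `N_B = ∑ Bⁱ` agree modulo `p`, because
`p N_A = N_B N_A = N_A N_B = p N_B`. In `V_{p-1}(K)` every non-trivial substitution
`x ↦ x + a y`, `y ↦ y` has only the multiples of `y^{p-1}` as fixed vectors, while its norm maps
`x^{p-1}` to `-a^{p-1} y^{p-1}`. A lift to `ℤ / p²` therefore forces `a^{p-1} = 1` for all
`a ≠ 0`, so that `K = 𝔽_p`.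

Conversely, if `K` has `q` elements, then forms of degree `q - 1` are well-defined functions on
the projective line, and they are exactly the functions whose values sum to zero. The functions with
sum zero form a lattice in a permutation module over any ring, which provides the lifts. -/

/-! ### Norms of commuting automorphisms -/

section GeomSum

variable {R M : Type*} [Semiring R] [AddCommGroup M] [Module R M] {A B : Module.End R M} {n : ℕ}

theorem apply_geomSum_apply_of_pow_eq_one (hA : A ^ n = 1) (m : M) :
    A ((∑ i ∈ Finset.range n, A ^ i) m) = (∑ i ∈ Finset.range n, A ^ i) m := by
  have h := mul_geom_sum A n
  rw [hA, sub_self, sub_mul, one_mul, sub_eq_zero] at h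
  exact DFunLike.congr_fun h m

theorem pow_apply_of_apply_eq_add {N : Type*} [AddCommMonoid N] [Module R N] {B : Module.End R N}
    {w u : N} (hw : B w = w + u) (hu : B u = u) (i : ℕ) :
    (B ^ i) w = w + i • u := by
  induction i with
  | zero => simp
  | succ i ih => rw [pow_succ', Module.End.mul_apply, ih, map_add, map_nsmul, hw, hu, succ_nsmul',
      add_assoc]

theorem geomSum_apply_of_apply_eq_add {N : Type*} [AddCommMonoid N] [Module R N]
    {B : Module.End R N} {w u : N} (hw : B w = w + u) (hu : B u = u) :
    (∑ i ∈ Finset.range n, B ^ i) w = n • w + n.choose 2 • u := by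
  simp only [LinearMap.sum_apply, pow_apply_of_apply_eq_add hw hu, Finset.sum_add_distrib,
    Finset.sum_const, Finset.card_range, ← Finset.sum_smul, Finset.sum_range_id,
    Nat.choose_two_right]

theorem dvd_choose_two_of_odd (hn : Odd n) : n ∣ n.choose 2 := by
  obtain ⟨k, rfl⟩ := hn
  rw [Nat.choose_two_right, Nat.add_sub_cancel, mul_left_comm, Nat.mul_div_cancel_left _ two_pos]
  exact dvd_mul_right _ _

-- The norm `w` of `m` under `A` is fixed by `A`, so `B w - w` is killed by `n` and is thus of the
-- form `n • u`; it is again fixed by `A`, hence by `B`, whence `Bⁱ w = w + i • n • u`.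
theorem geomSum_apply_geomSum_apply (hn : Odd n) (htors : ∀ m : M, n • m = 0 → ∃ u, n • u = m)
    (hA : A ^ n = 1) (hAB : Commute A B)
    (hfix : ∀ m, A (n • m) = n • m → B (n • m) = n • m) (m : M) :
    (∑ i ∈ Finset.range n, B ^ i) ((∑ i ∈ Finset.range n, A ^ i) m) =
      n • (∑ i ∈ Finset.range n, A ^ i) m := by
  set w := (∑ i ∈ Finset.range n, A ^ i) m
  have hAw : A w = w := apply_geomSum_apply_of_pow_eq_one hA m
  have hnw : n • (B w - w) = 0 := by
    rw [smul_sub, ← map_nsmul, hfix w (by rw [map_nsmul, hAw]), sub_self]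
  obtain ⟨u, hu⟩ := htors _ hnw
  have hAu : A (n • u) = n • u := by
    rw [hu, map_sub, hAw, ← Module.End.mul_apply, hAB.eq, Module.End.mul_apply, hAw]
  obtain ⟨k, hk⟩ := dvd_choose_two_of_odd hn
  rw [geomSum_apply_of_apply_eq_add (u := n • u) (by rw [hu, add_sub_cancel]) (hfix u hAu), hk,
    mul_comm, mul_smul, hu, hnw, smul_zero, add_zero]

theorem nsmul_geomSum_apply_eq (hn : Odd n) (htors : ∀ m : M, n • m = 0 → ∃ u, n • u = m)
    (hA : A ^ n = 1) (hB : B ^ n = 1) (hAB : Commute A B)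
    (hfix : ∀ m, A (n • m) = n • m ↔ B (n • m) = n • m) (m : M) :
    n • (∑ i ∈ Finset.range n, A ^ i) m = n • (∑ i ∈ Finset.range n, B ^ i) m := by
  rw [← geomSum_apply_geomSum_apply hn htors hA hAB fun m => (hfix m).1,
    ← geomSum_apply_geomSum_apply hn htors hB hAB.symm fun m => (hfix m).2,
    ← Module.End.mul_apply, ← Module.End.mul_apply]
  have hcomm : Commute (∑ i ∈ Finset.range n, B ^ i) (∑ i ∈ Finset.range n, A ^ i) :=
    Commute.sum_left _ _ _ fun i _ => Commute.sum_right _ _ _ fun j _ => hAB.symm.pow_pow i j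
  rw [hcomm.eq]

end GeomSum

/-! ### Lifting representations along a ring homomorphism -/

section Reduction

variable {R k G V ι : Type*} [CommRing R] [CommRing k] [Monoid G] [AddCommGroup V] [Module k V]
  {f : R →+* k}

/-- The reduction `∑ mᵢ eᵢ ↦ ∑ f(mᵢ) bᵢ` from the free module `R^ι` to the module `V` with
basis `b`. -/
noncomputable def reductionMap [Finite ι] (f : R →+* k) (b : Module.Basis ι k V) :
    (ι → R) →ₛₗ[f] V where
  toFun m := b.equivFun.symm (f ∘ m)
  map_add' m m' := by
    rw [← map_add]
    congr 1
    ext i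
    simp
  map_smul' c m := by
    rw [← map_smul]
    congr 1
    ext i
    simp

theorem reductionMap_apply [Finite ι] (b : Module.Basis ι k V) (m : ι → R) :
    reductionMap f b m = b.equivFun.symm (f ∘ m) := rfl

theorem reductionMap_surjective [Finite ι] (hf : Function.Surjective f) (b : Module.Basis ι k V) :
    Function.Surjective (reductionMap f b) :=
  b.equivFun.symm.surjective.comp hf.comp_left

theorem reductionMap_eq_zero_iff [Finite ι] (b : Module.Basis ι k V) {m : ι → R} :
    reductionMap f b m = 0 ↔ ∀ i, f (m i) = 0 := by
  rw [reductionMap_apply, LinearEquiv.map_eq_zero_iff, funext_iff]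
  rfl

theorem ker_reductionMap [Finite ι] (b : Module.Basis ι k V) :
    LinearMap.ker (reductionMap f b) = RingHom.ker f • ⊤ := by
  classical
  have := Fintype.ofFinite ι
  refine le_antisymm (fun m hm => ?_) (Submodule.smul_le.2 fun c hc m _ => ?_)
  · rw [LinearMap.mem_ker, reductionMap_eq_zero_iff] at hm
    rw [pi_eq_sum_univ' m]
    exact Submodule.sum_mem _ fun i _ => Submodule.smul_mem_smul (hm i) trivial
  · rw [LinearMap.mem_ker, map_smulₛₗ, RingHom.mem_ker.1 hc, zero_smul]

/-- A representation `ρ` over `k` lifts along `f : R →+* k` if, for some basis of its underlying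
module, `G` acts on the free module `Rⁿ` in such a way that the reduction from `Rⁿ` is
equivariant. -/
def LiftsAlong (f : R →+* k) (ρ : Representation k G V) : Prop :=
  ∃ (n : ℕ) (b : Module.Basis (Fin n) k V) (σ : Representation R G (Fin n → R)),
    ∀ g m, reductionMap f b (σ g m) = ρ g (reductionMap f b m)

theorem equivFun_reductionMap [Finite ι] (b : Module.Basis ι k V) (m : ι → R) :
    b.equivFun (reductionMap f b m) = f ∘ m :=
  b.equivFun.apply_symm_apply _

theorem reductionMap_single [Finite ι] [DecidableEq ι] (b : Module.Basis ι k V) (i : ι) :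
    reductionMap f b (Pi.single i 1) = b i := by
  apply b.equivFun.injective
  rw [equivFun_reductionMap, Module.Basis.equivFun_apply, b.repr_self, Finsupp.single_eq_pi_single]
  ext j
  rw [Function.comp_apply, Pi.apply_single (fun _ => f) fun _ => map_zero f, map_one]

theorem reductionMap_comp_eq_iff_toMatrix [Fintype ι] [DecidableEq ι] (b : Module.Basis ι k V)
    (T : (ι → R) →ₗ[R] (ι → R)) (S : V →ₗ[k] V) :
    (∀ m, reductionMap f b (T m) = S (reductionMap f b m)) ↔
      (LinearMap.toMatrix' T).map f = LinearMap.toMatrix b b S := by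
  have hbasis : (∀ m, reductionMap f b (T m) = S (reductionMap f b m)) ↔
      ∀ j, reductionMap f b (T (Pi.single j 1)) = S (b j) := by
    refine ⟨fun h j => by rw [h, reductionMap_single], fun h => DFunLike.congr_fun (f :=
      (reductionMap f b).comp T) (g := S.comp (reductionMap f b)) ?_⟩
    refine (Pi.basisFun R ι).ext fun j => ?_
    rw [LinearMap.comp_apply, LinearMap.comp_apply, Pi.basisFun_apply, h, reductionMap_single]
  rw [hbasis, ← Matrix.ext_iff, forall_comm]
  refine forall_congr' fun j => ?_
  rw [← b.equivFun.injective.eq_iff, equivFun_reductionMap, funext_iff]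
  simp only [Function.comp_apply, Module.Basis.equivFun_apply, Matrix.map_apply,
    LinearMap.toMatrix'_apply, LinearMap.toMatrix_apply]

theorem LiftsAlong.sum_pow_eq_sum_pow {ρ : Representation k G V} (hρ : LiftsAlong f ρ)
    (hf : Function.Surjective f) {n : ℕ} (hn : Odd n) (hker : ∀ x, f x = 0 ↔ n • x = 0)
    (htors : ∀ x : R, n • x = 0 → ∃ y, n • y = x) {g h : G} (hg : g ^ n = 1) (hh : h ^ n = 1)
    (hgh : Commute g h) (hfix : ∀ v, ρ g v = v ↔ ρ h v = v) (v : V) :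
    ∑ i ∈ Finset.range n, ρ (g ^ i) v = ∑ i ∈ Finset.range n, ρ (h ^ i) v := by
  obtain ⟨d, b, σ, hσ⟩ := hρ
  have hzero (m : Fin d → R) : reductionMap f b m = 0 ↔ n • m = 0 := by
    simp only [reductionMap_eq_zero_iff, hker, funext_iff, Pi.smul_apply, Pi.zero_apply]
  have hfixed (x : G) (m : Fin d → R) :
      σ x (n • m) = n • m ↔ ρ x (reductionMap f b m) = reductionMap f b m := by
    rw [map_nsmul, ← sub_eq_zero, ← smul_sub, ← hzero, map_sub, hσ, sub_eq_zero]
  have hdiv (m : Fin d → R) (hm : n • m = 0) : ∃ u, n • u = m := by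
    choose u hu using fun i => htors (m i) (congrFun hm i)
    exact ⟨u, funext hu⟩
  obtain ⟨m, rfl⟩ := reductionMap_surjective hf b v
  have key := nsmul_geomSum_apply_eq hn hdiv (by rw [← map_pow, hg, map_one])
    (by rw [← map_pow, hh, map_one]) (hgh.map σ) (fun m => by rw [hfixed, hfixed, hfix]) m
  rw [← sub_eq_zero, ← smul_sub, ← hzero, map_sub, sub_eq_zero] at key
  simpa only [LinearMap.sum_apply, map_sum, ← map_pow, hσ] using key

end Reduction

section ZModPow

variable {p : ℕ} {G V : Type*} [Group G] [AddCommGroup V] [Module (ZMod p) V]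
  {ρ : Representation (ZMod p) G V}

theorem liftsToZModPow_iff_liftsAlong {s : ℕ} (hs : s ≠ 0) :
    LiftsToZModPow ρ s hs ↔ LiftsAlong (ZMod.castHom (dvd_pow_self p hs) (ZMod p)) ρ := by
  constructor
  · rintro ⟨n, b, θ, hθ⟩
    refine ⟨n, b, Matrix.toLinAlgEquiv'.toMulEquiv.toMonoidHom.comp ((Units.coeHom _).comp θ),
      fun g => (reductionMap_comp_eq_iff_toMatrix b _ _).2 ?_⟩
    rw [← hθ]
    exact congrArg (Matrix.map · _) (LinearMap.toMatrix'_toLin' (θ g).1)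
  · rintro ⟨n, b, σ, hσ⟩
    let θ := (LinearMap.toMatrixAlgEquiv' (R := ZMod (p ^ s)) (n := Fin n)).toMulEquiv.toMonoidHom
    exact ⟨n, b, (θ.comp σ).toHomUnits, fun g => (reductionMap_comp_eq_iff_toMatrix b _ _).1 (hσ g)⟩

theorem castHom_sq_eq_zero_iff [NeZero p] (x : ZMod (p ^ 2)) :
    ZMod.castHom (dvd_pow_self p two_ne_zero) (ZMod p) x = 0 ↔ p • x = 0 := by
  obtain ⟨v, rfl⟩ := ZMod.natCast_zmod_surjective x
  rw [map_natCast, nsmul_eq_mul, ← Nat.cast_mul, ZMod.natCast_eq_zero_iff,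
    ZMod.natCast_eq_zero_iff, sq, Nat.mul_dvd_mul_iff_left (NeZero.pos p)]

theorem exists_nsmul_eq_of_nsmul_eq_zero [NeZero p] (x : ZMod (p ^ 2)) (hx : p • x = 0) :
    ∃ y, p • y = x := by
  rw [← castHom_sq_eq_zero_iff] at hx
  obtain ⟨v, rfl⟩ := ZMod.natCast_zmod_surjective x
  rw [map_natCast, ZMod.natCast_eq_zero_iff] at hx
  obtain ⟨w, rfl⟩ := hx
  exact ⟨w, by rw [nsmul_eq_mul, Nat.cast_mul]⟩

theorem LiftsToZModPow.sum_pow_eq_sum_pow [NeZero p] (hρ : LiftsToZModPow ρ 2 two_ne_zero)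
    (hp : Odd p) {g h : G} (hg : g ^ p = 1) (hh : h ^ p = 1) (hgh : Commute g h)
    (hfix : ∀ v, ρ g v = v ↔ ρ h v = v) (v : V) :
    ∑ i ∈ Finset.range p, ρ (g ^ i) v = ∑ i ∈ Finset.range p, ρ (h ^ i) v :=
  ((liftsToZModPow_iff_liftsAlong two_ne_zero).1 hρ).sum_pow_eq_sum_pow
    (ZMod.castHom_surjective _) hp castHom_sq_eq_zero_iff exists_nsmul_eq_of_nsmul_eq_zero
    hg hh hgh hfix v

end ZModPow

section Lattice

variable {R k G V ι : Type*} [CommRing R] [CommRing k] [Monoid G] [AddCommGroup V] [Module k V]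
  {f : R →+* k} {ρ : Representation k G V}

theorem reductionMap_reindex {κ : Type*} [Finite ι] [Finite κ] (b : Module.Basis ι k V) (e : ι ≃ κ)
    (m : κ → R) : reductionMap f (b.reindex e) m = reductionMap f b (m ∘ e) := by
  rw [reductionMap_apply, LinearEquiv.symm_apply_eq]
  ext j
  rw [Module.Basis.equivFun_apply, Module.Basis.repr_reindex_apply, ← Module.Basis.equivFun_apply,
    equivFun_reductionMap, Function.comp_apply, Function.comp_apply, Function.comp_apply,
    e.apply_symm_apply]

theorem LiftsAlong.of_basis [Finite ι] (b : Module.Basis ι k V) (σ : Representation R G (ι → R))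
    (hσ : ∀ g m, reductionMap f b (σ g m) = ρ g (reductionMap f b m)) : LiftsAlong f ρ := by
  obtain ⟨n, ⟨e⟩⟩ := Finite.exists_equiv_fin ι
  let E : (ι → R) ≃ₗ[R] (Fin n → R) := LinearEquiv.funCongrLeft R R e.symm
  refine ⟨n, b.reindex e, (E.conjAlgEquiv R).toMulEquiv.toMonoidHom.comp σ, fun g m => ?_⟩
  rw [reductionMap_reindex, reductionMap_reindex, ← hσ]
  congr 1
  ext i
  exact congrArg (σ g (m ∘ e)) (e.symm_apply_apply i)

theorem exists_addEquiv_quotient_of_ker_eq {M : Type*} [AddCommGroup M] [Module R M]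
    {π : M →ₛₗ[f] V} (hπ : Function.Surjective π) {N : Submodule R M}
    (hN : LinearMap.ker π = N) : ∃ e : (M ⧸ N) ≃+ V, ∀ m, e (Submodule.Quotient.mk m) = π m := by
  refine ⟨AddEquiv.ofBijective (N.liftQ π hN.ge) ⟨?_, fun v => ?_⟩, fun m => rfl⟩
  · rw [← LinearMap.ker_eq_bot, Submodule.ker_liftQ, hN, Submodule.mkQ_map_self]
  · obtain ⟨m, rfl⟩ := hπ v
    exact ⟨Submodule.Quotient.mk m, rfl⟩

variable (R) (F : Type*) [CommRing F] [Algebra R F]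

/-- The inclusion `R^ι → F^ι` of the standard lattice. -/
noncomputable def coordInclusion (ι : Type*) : (ι → R) →ₗ[R] (ι → F) :=
  (Algebra.linearMap R F).compLeft ι

variable {R}

theorem coordInclusion_apply (m : ι → R) (i : ι) :
    coordInclusion R F ι m i = algebraMap R F (m i) := rfl

theorem coordInclusion_injective [FaithfulSMul R F] : Function.Injective (coordInclusion R F ι) :=
  (FaithfulSMul.algebraMap_injective R F).comp_left

theorem span_range_coordInclusion [Finite ι] :
    Submodule.span F (LinearMap.range (coordInclusion R F ι) : Set (ι → F)) = ⊤ := by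
  classical
  rw [eq_top_iff, ← (Pi.basisFun F ι).span_eq]
  refine Submodule.span_mono ?_
  rintro _ ⟨i, rfl⟩
  refine ⟨Pi.single i 1, funext fun j => ?_⟩
  rw [coordInclusion_apply, Pi.basisFun_apply, Pi.apply_single (fun _ => algebraMap R F)
    fun _ => map_zero _, map_one]

/-- Extension of scalars of a representation on `R^ι`, in coordinates. -/
noncomputable def coordBaseChange [Fintype ι] [DecidableEq ι] (σ : Representation R G (ι → R)) :
    Representation F G (ι → F) :=
  Matrix.toLinAlgEquiv'.toMulEquiv.toMonoidHom.comp
    ((algebraMap R F).mapMatrix.toMonoidHom.comp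
      (LinearMap.toMatrixAlgEquiv'.toMulEquiv.toMonoidHom.comp σ))

theorem coordBaseChange_coordInclusion [Fintype ι] [DecidableEq ι]
    (σ : Representation R G (ι → R)) (g : G) (m : ι → R) :
    coordBaseChange F σ g (coordInclusion R F ι m) = coordInclusion R F ι (σ g m) := by
  rw [← LinearMap.toMatrix'_mulVec (σ g) m]
  ext i
  exact ((algebraMap R F).map_mulVec _ _ _).symm

end Lattice

theorem LiftsAlong.liftsToPadic {p : ℕ} [Fact p.Prime] {G V : Type*} [Group G] [AddCommGroup V]
    [Module (ZMod p) V] {ρ : Representation (ZMod p) G V}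
    (hρ : LiftsAlong (PadicInt.toZMod (p := p)) ρ) : LiftsToPadic ρ := by
  obtain ⟨n, b, σ, hσ⟩ := hρ
  let ψ := LinearEquiv.ofInjective _ (coordInclusion_injective (R := ℤ_[p]) (ι := Fin n) ℚ_[p])
  let π := (reductionMap PadicInt.toZMod b).comp ψ.symm.toLinearMap
  have hψ (g : G) (m : Fin n → ℤ_[p]) : coordBaseChange ℚ_[p] σ g (ψ m) = ψ (σ g m) :=
    coordBaseChange_coordInclusion ℚ_[p] σ g m
  have hπψ (m : Fin n → ℤ_[p]) : π (ψ m) = reductionMap PadicInt.toZMod b m :=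
    congrArg (reductionMap PadicInt.toZMod b) (ψ.symm_apply_apply m)
  have hπ : Function.Surjective π :=
    (reductionMap_surjective (ZMod.ringHom_surjective _) b).comp ψ.symm.surjective
  have hker : LinearMap.ker π = Ideal.span {(p : ℤ_[p])} • ⊤ := by
    rw [LinearMap.ker_comp, ker_reductionMap, PadicInt.ker_toZMod, PadicInt.maximalIdeal_eq_span_p,
      ← Submodule.map_equiv_eq_comap_symm, Submodule.map_smul'', Submodule.map_top, ψ.range]
  have hmem (g : G) (v : LinearMap.range (coordInclusion ℤ_[p] ℚ_[p] (Fin n))) :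
      coordBaseChange ℚ_[p] σ g v ∈ LinearMap.range (coordInclusion ℤ_[p] ℚ_[p] (Fin n)) := by
    obtain ⟨m, rfl⟩ := ψ.surjective v
    exact hψ g m ▸ (ψ (σ g m)).2
  obtain ⟨e, he⟩ := exists_addEquiv_quotient_of_ker_eq hπ hker
  refine ⟨n, coordBaseChange ℚ_[p] σ, _, ⟨Submodule.FG.of_finite, span_range_coordInclusion ℚ_[p]⟩,
    hmem, e, fun g v => ?_⟩
  obtain ⟨m, rfl⟩ := ψ.surjective v
  have hψ' : (⟨_, hmem g (ψ m)⟩ : LinearMap.range _) = ψ (σ g m) := Subtype.ext (hψ g m)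
  rw [he, he, hψ', hπψ, hπψ, hσ]

/-! ### Unipotent action on binary forms -/

section BinaryForm

variable {K : Type*} [CommRing K] {n : ℕ}

/-- The binary form `∑ aᵢ xⁱ yⁿ⁻ⁱ` of degree `n` with dehomogenization `∑ aᵢ Xⁱ`; coefficients of
degree greater than `n` are dropped. -/
noncomputable def binaryForm (n : ℕ) : Polynomial K →ₗ[K] homogeneousSubmodule (Fin 2) K n :=
  (Polynomial.homogenizeLM n).codRestrict _ fun P =>
    (mem_homogeneousSubmodule n _).2 (Polynomial.isHomogeneous_homogenize P)

theorem coe_binaryForm (P : Polynomial K) :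
    (binaryForm n P : MvPolynomial (Fin 2) K) = P.homogenize n := rfl

theorem exists_binaryForm_eq (f : homogeneousSubmodule (Fin 2) K n) :
    ∃ P : Polynomial K, P.natDegree ≤ n ∧ binaryForm n P = f := by
  have hf := (mem_homogeneousSubmodule n f.1).1 f.2
  refine ⟨aeval ![Polynomial.X, 1] f.1, ?_,
    Subtype.ext (Polynomial.homogenize_eq_of_isHomogeneous hf rfl)⟩
  refine (MvPolynomial.aeval_natDegree_le f.1 hf.totalDegree_le _ fun i => ?_).trans_eq (mul_one n)
  fin_cases i
  · exact Polynomial.natDegree_X_le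
  · exact Polynomial.natDegree_one.trans_le zero_le_one

theorem binaryForm_injOn : Set.InjOn (binaryForm (K := K) n) {P | P.natDegree ≤ n} := by
  intro P hP Q hQ h
  rw [← Polynomial.aeval_homogenize_X_one P hP, ← Polynomial.aeval_homogenize_X_one Q hQ,
    ← coe_binaryForm, h, coe_binaryForm]

theorem aeval_polySubst {A : Type*} [CommRing A] [Algebra K A] (g : Matrix (Fin 2) (Fin 2) K)
    (v : Fin 2 → A) (f : MvPolynomial (Fin 2) K) :
    aeval v (polySubst g f) = aeval (g.map (algebraMap K A) *ᵥ v) f := by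
  have h : (aeval v).comp (polySubst g) = aeval (R := K) (g.map (algebraMap K A) *ᵥ v) := by
    apply MvPolynomial.algHom_ext
    intro i
    fin_cases i <;> simp [polySubst]
  exact DFunLike.congr_fun h f

theorem eval_homPolyRep (k : Type*) [CommRing k] [Algebra k K]
    (g : Matrix.SpecialLinearGroup (Fin 2) K) (f : homogeneousSubmodule (Fin 2) K n)
    (v : Fin 2 → K) :
    eval v (homPolyRep k K n g f).1 =
      eval ((g⁻¹ : Matrix.SpecialLinearGroup (Fin 2) K).1 *ᵥ v) f.1 :=
  aeval_polySubst _ v f.1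

/-- The unipotent subgroup of `SL₂(K)`; the sign is chosen so that `shear a` acts on forms by
`x ↦ x + a y`, `y ↦ y`. -/
def shear : AddChar K (Matrix.SpecialLinearGroup (Fin 2) K) where
  toFun a := ⟨!![1, -a; 0, 1], by simp [Matrix.det_fin_two]⟩
  map_zero_eq_one' := by
    ext i j
    fin_cases i <;> fin_cases j <;> simp
  map_add_eq_mul' a b := by
    have h : (!![1, -(a + b); 0, 1] : Matrix _ _ K) = !![1, -a; 0, 1] * !![1, -b; 0, 1] := by simp
    exact Subtype.ext h

theorem shear_inv_val (a : K) :
    ((shear a)⁻¹ : Matrix.SpecialLinearGroup (Fin 2) K).1 = !![1, a; 0, 1] := by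
  rw [← AddChar.map_neg_eq_inv]
  exact congrArg (fun b => !![1, b; 0, 1]) (neg_neg a)

theorem homPolyRep_shear_binaryForm (k : Type*) [CommRing k] [Algebra k K] (a : K)
    {P : Polynomial K} (hP : P.natDegree ≤ n) :
    homPolyRep k K n (shear a) (binaryForm n P) = binaryForm n (Polynomial.taylor a P) := by
  refine Subtype.ext (Polynomial.homogenize_eq_of_isHomogeneous
    ((mem_homogeneousSubmodule n _).1 (homPolyRep k K n (shear a) (binaryForm n P)).2) ?_).symm
  refine (aeval_polySubst _ _ _).trans ?_
  rw [shear_inv_val]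
  refine (Polynomial.aeval_homogenize_of_eq_one hP _ (by simp)).trans ?_
  rw [Polynomial.taylor_apply, Polynomial.comp_eq_aeval]
  simp

theorem eval_sum_homPolyRep_shear_pow (k : Type*) [CommRing k] [Algebra k K] (a : K) (m : ℕ) :
    eval ![0, 1] (∑ i ∈ Finset.range m,
      homPolyRep k K n (shear a ^ i) (binaryForm n (Polynomial.X ^ n))).1 =
        (∑ i ∈ Finset.range m, (i : K) ^ n) * a ^ n := by
  rw [AddSubmonoidClass.coe_finsetSum, map_sum, Finset.sum_mul]
  refine Finset.sum_congr rfl fun i _ => ?_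
  rw [← AddChar.map_nsmul_eq_pow, eval_homPolyRep, shear_inv_val, coe_binaryForm,
    Polynomial.homogenize_X_pow le_rfl]
  simp [mul_pow]

end BinaryForm

theorem eq_C_of_taylor_eq_self {K : Type*} [CommRing K] [IsDomain K] {p : ℕ} [CharP K p]
    {P : Polynomial K} (hP : P.natDegree < p) {a : K} (ha : a ≠ 0)
    (h : Polynomial.taylor a P = P) : P = Polynomial.C (P.eval 0) := by
  have heval (i : ℕ) : P.eval (i * a) = P.eval 0 := by
    induction i with
    | zero => rw [Nat.cast_zero, zero_mul]
    | succ i ih => rw [← ih, Nat.cast_succ, add_one_mul, ← Polynomial.taylor_eval, h]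
  have hinj : Function.Injective fun i : Fin p => (i * a : K) := fun i j hij =>
    Fin.ext (CharP.natCast_injOn_Iio K p i.2 j.2 (mul_right_cancel₀ ha hij))
  refine Polynomial.eq_of_natDegree_lt_card_of_eval_eq P _ hinj (fun i => ?_) ?_
  · rw [heval, Polynomial.eval_C]
  · rwa [Polynomial.natDegree_C, max_eq_left (Nat.zero_le _), Fintype.card_fin]

theorem homPolyRep_shear_eq_self_iff (k : Type*) {K : Type*} [CommRing k] [CommRing K] [IsDomain K]
    [Algebra k K] {p n : ℕ} [CharP K p] (hn : n < p) {a : K} (ha : a ≠ 0)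
    (f : homogeneousSubmodule (Fin 2) K n) :
    homPolyRep k K n (shear a) f = f ↔ ∃ c, binaryForm n (Polynomial.C c) = f := by
  constructor
  · intro hf
    obtain ⟨P, hP, rfl⟩ := exists_binaryForm_eq f
    rw [homPolyRep_shear_binaryForm k a hP] at hf
    have htaylor : Polynomial.taylor a P = P :=
      binaryForm_injOn ((Polynomial.natDegree_taylor P a).trans_le hP) hP hf
    exact ⟨P.eval 0, by rw [← eq_C_of_taylor_eq_self (hP.trans_lt hn) ha htaylor]⟩
  · rintro ⟨c, rfl⟩
    rw [homPolyRep_shear_binaryForm k a (by simp), Polynomial.taylor_C]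

theorem sum_pow_eq_neg_one {K : Type*} [Field K] [Fintype K] {n : ℕ}
    (hn : n + 1 = Fintype.card K) : ∑ t : K, t ^ n = -1 := by
  classical
  have hn0 : n ≠ 0 := by
    have := Fintype.one_lt_card (α := K)
    lia
  have hfermat (t : K) (ht : t ∈ Finset.univ.erase 0) : t ^ n = 1 := by
    rw [← FiniteField.pow_card_sub_one_eq_one t (Finset.ne_of_mem_erase ht), ← hn,
      Nat.add_sub_cancel]
  rw [← Finset.sum_erase _ (zero_pow hn0), Finset.sum_congr rfl hfermat, Finset.sum_const,
    Finset.card_erase_of_mem (Finset.mem_univ _), Finset.card_univ, ← hn, Nat.add_sub_cancel,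
    nsmul_one, eq_neg_iff_add_eq_zero, ← Nat.cast_add_one, hn, FiniteField.cast_card_eq_zero]

theorem sum_range_pow_prime_sub_one (p : ℕ) [hp : Fact p.Prime] (K : Type*) [Ring K] [CharP K p] :
    ∑ i ∈ Finset.range p, (i : K) ^ (p - 1) = -1 := by
  have hcard : p - 1 + 1 = Fintype.card (ZMod p) := by
    rw [ZMod.card, Nat.sub_add_cancel hp.out.one_le]
  have hrange : ∑ i ∈ Finset.range p, (i : ZMod p) ^ (p - 1) = ∑ t : ZMod p, t ^ (p - 1) :=
    Finset.sum_nbij' (fun i => (i : ZMod p)) ZMod.val (fun _ _ => Finset.mem_univ _)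
      (fun t _ => Finset.mem_range.2 (ZMod.val_lt t))
      (fun _ hi => ZMod.val_cast_of_lt (Finset.mem_range.1 hi))
      (fun t _ => ZMod.natCast_zmod_val t) fun _ _ => rfl
  have h := congrArg (ZMod.castHom dvd_rfl K) (hrange.trans (sum_pow_eq_neg_one hcard))
  simpa only [map_sum, map_pow, map_natCast, map_neg, map_one] using h

theorem pow_sub_one_eq_one_of_liftsToZModPow {p : ℕ} [Fact p.Prime] (hp : Odd p) {K : Type*}
    [CommRing K] [IsDomain K] [Algebra (ZMod p) K]
    (hlift : LiftsToZModPow (homPolyRep (ZMod p) K (p - 1)) 2 two_ne_zero) {a : K} (ha : a ≠ 0) :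
    a ^ (p - 1) = 1 := by
  have := charP_of_injective_algebraMap (FaithfulSMul.algebraMap_injective (ZMod p) K) p
  have hexp (b : K) : shear b ^ p = 1 := by
    rw [← AddChar.map_nsmul_eq_pow, nsmul_eq_mul, CharP.cast_eq_zero, zero_mul,
      AddChar.map_zero_eq_one]
  have hfix (f : homogeneousSubmodule (Fin 2) K (p - 1)) :
      homPolyRep (ZMod p) K _ (shear a) f = f ↔ homPolyRep (ZMod p) K _ (shear 1) f = f := by
    have hlt : p - 1 < p := Nat.sub_one_lt (NeZero.ne p)
    rw [homPolyRep_shear_eq_self_iff _ hlt ha, homPolyRep_shear_eq_self_iff _ hlt one_ne_zero]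
  have hcomm : Commute (shear a) (shear 1) := by
    rw [Commute, SemiconjBy, ← AddChar.map_add_eq_mul, add_comm, AddChar.map_add_eq_mul]
  have hnorm := hlift.sum_pow_eq_sum_pow hp (hexp a) (hexp 1) hcomm hfix
    (binaryForm (p - 1) (Polynomial.X ^ (p - 1)))
  have heval := congrArg (fun f => eval ![0, 1] f.1) hnorm
  simpa only [eval_sum_homPolyRep_shear_pow, sum_range_pow_prime_sub_one, one_pow, neg_mul,
    one_mul, neg_inj] using heval

theorem natCard_eq_of_forall_pow_sub_one_eq_one {K : Type*} [Field K] {p : ℕ} [Fact p.Prime]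
    [CharP K p] (h : ∀ a : K, a ≠ 0 → a ^ (p - 1) = 1) : Nat.card K = p := by
  have htop : (⊥ : Subfield K) = ⊤ := by
    refine eq_top_iff.2 fun a _ => (Subfield.mem_bot_iff_pow_eq_self K p).2 ?_
    obtain rfl | ha := eq_or_ne a 0
    · exact zero_pow (NeZero.ne p)
    · rw [← pow_sub_one_mul (NeZero.ne p), h a ha, one_mul]
  rw [← Nat.card_congr Subfield.topEquiv.toEquiv, ← htop, Subfield.card_bot K p]

/-! ### The Steinberg module as a permutation module -/

section SumZero

variable {A B G β : Type*} [CommRing A] [CommRing B] [Group G] [Fintype β]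

/-- The extension of a function on `β` to the function on `OnePoint β` with sum zero. -/
noncomputable def sumZeroExtend (A β : Type*) [CommRing A] [Fintype β] :
    (β → A) →ₗ[A] (OnePoint β → A) where
  toFun f x := x.elim (-∑ b, f b) f
  map_add' f f' := by
    ext x
    cases x
    · simp [Finset.sum_add_distrib, add_comm]
    · rfl
  map_smul' c f := by
    ext x
    cases x
    · simp [Finset.mul_sum]
    · rfl

theorem sumZeroExtend_infty (f : β → A) : sumZeroExtend A β f OnePoint.infty = -∑ b, f b := rfl

theorem sumZeroExtend_coe (f : β → A) (b : β) : sumZeroExtend A β f b = f b := rfl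

theorem sum_onePoint (F : OnePoint β → A) : ∑ x, F x = F OnePoint.infty + ∑ b : β, F b :=
  Fintype.sum_option F

theorem sum_sumZeroExtend (f : β → A) : ∑ x, sumZeroExtend A β f x = 0 := by
  simp only [sum_onePoint, sumZeroExtend_infty, sumZeroExtend_coe, neg_add_cancel]

theorem sumZeroExtend_comp_coe {F : OnePoint β → A} (hF : ∑ x, F x = 0) :
    sumZeroExtend A β (fun b => F b) = F := by
  ext x
  cases x
  · rw [sumZeroExtend_infty, neg_eq_iff_add_eq_zero, add_comm, ← sum_onePoint, hF]
  · rfl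

theorem map_sumZeroExtend (φ : A →+* B) (f : β → A) (x : OnePoint β) :
    φ (sumZeroExtend A β f x) = sumZeroExtend B β (φ ∘ f) x := by
  cases x
  · simp [sumZeroExtend_infty]
  · rfl

variable [MulAction G (OnePoint β)]

theorem sumZeroExtend_comp_smul (g : G) (f : β → A) :
    sumZeroExtend A β (fun b => sumZeroExtend A β f (g • (b : OnePoint β))) =
      fun x => sumZeroExtend A β f (g • x) :=
  sumZeroExtend_comp_coe
    ((Equiv.sum_comp (MulAction.toPerm g) (sumZeroExtend A β f)).trans (sum_sumZeroExtend f))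

/-- The permutation representation of `G` on the functions with sum zero on `OnePoint β`, in the
coordinates given by restriction to `β`. -/
noncomputable def sumZeroRep (A : Type*) {G β : Type*} [CommRing A] [Group G] [Fintype β]
    [MulAction G (OnePoint β)] : Representation A G (β → A) where
  toFun g := LinearMap.funLeft A A (fun b : β => g⁻¹ • (b : OnePoint β)) ∘ₗ sumZeroExtend A β
  map_one' := by
    ext f b
    simp [LinearMap.funLeft_apply, sumZeroExtend_coe]
  map_mul' g h := by
    refine LinearMap.ext fun f => funext fun b => ?_
    refine .trans ?_ (congrFun (sumZeroExtend_comp_smul h⁻¹ f) (g⁻¹ • (b : OnePoint β))).symm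
    rw [LinearMap.comp_apply, LinearMap.funLeft_apply, _root_.mul_inv_rev, mul_smul]

theorem sumZeroRep_apply (g : G) (f : β → A) (b : β) :
    sumZeroRep A g f b = sumZeroExtend A β f (g⁻¹ • (b : OnePoint β)) := rfl

theorem comp_sumZeroRep (φ : A →+* B) (g : G) (f : β → A) :
    φ ∘ sumZeroRep A g f = sumZeroRep B g (φ ∘ f) :=
  funext fun _ => map_sumZeroExtend φ f _

end SumZero

section AffineValues

variable {K : Type*} [CommRing K] {n : ℕ}

/-- Homogeneous coordinates on the projective line `OnePoint K`. -/
def homogeneousCoords (x : OnePoint K) : Fin 2 → K :=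
  x.elim ![1, 0] fun t => ![t, 1]

theorem eval_coe_binaryForm {P : Polynomial K} (hP : P.natDegree ≤ n) (t : K) :
    eval (homogeneousCoords t) (binaryForm n P).1 = P.eval t :=
  Polynomial.aeval_homogenize_of_eq_one hP ![t, 1] rfl

theorem eval_infty_binaryForm (P : Polynomial K) :
    eval (homogeneousCoords OnePoint.infty) (binaryForm n P).1 = P.coeff n := by
  rw [coe_binaryForm, Polynomial.homogenize, map_sum]
  refine (Finset.sum_eq_single (n, 0) (fun d hd hne => ?_) (by simp)).trans ?_
  · have hd2 : d.2 ≠ 0 := by grind [Finset.HasAntidiagonal.mem_antidiagonal]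
    simp [homogeneousCoords, eval_monomial, hd2, Finsupp.prod_fintype]
  · simp [homogeneousCoords, eval_monomial, Finsupp.prod_fintype]

/-- The values of a binary form on the affine part of the projective line. -/
noncomputable def affineValues (n : ℕ) : homogeneousSubmodule (Fin 2) K n →ₗ[K] (K → K) :=
  LinearMap.pi fun t =>
    (aeval (R := K) (homogeneousCoords t)).toLinearMap ∘ₗ (homogeneousSubmodule (Fin 2) K n).subtype

theorem affineValues_apply (f : homogeneousSubmodule (Fin 2) K n) (t : K) :
    affineValues n f t = eval (homogeneousCoords t) f.1 := rfl

end AffineValues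

section ProjectiveLine

variable {K : Type*} [Field K] {n : ℕ}

theorem homogeneousCoords_ne_zero (x : OnePoint K) : homogeneousCoords x ≠ 0 := by
  cases x
  · exact fun h => one_ne_zero (congrFun h 0)
  · exact fun h => one_ne_zero (congrFun h 1)

theorem equivProjectivization_eq_mk [DecidableEq K] (x : OnePoint K) :
    OnePoint.equivProjectivization K x =
      Projectivization.mk K (homogeneousCoords x) (homogeneousCoords_ne_zero x) := by
  cases x <;> rfl

theorem exists_mulVec_homogeneousCoords [DecidableEq K] (g : GL (Fin 2) K) (x : OnePoint K) :
    ∃ c : K, c ≠ 0 ∧ g.1 *ᵥ homogeneousCoords x = c • homogeneousCoords (g • x) := by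
  have h := OnePoint.equivProjectivization_smul (g := g) x
  rw [equivProjectivization_eq_mk, equivProjectivization_eq_mk, Projectivization.smul_mk, eq_comm,
    Projectivization.mk_eq_mk_iff] at h
  obtain ⟨c, hc⟩ := h
  exact ⟨c, c.ne_zero, hc.symm⟩

theorem eval_smul_of_isHomogeneous {σ R : Type*} [CommRing R] {f : MvPolynomial σ R}
    (hf : f.IsHomogeneous n) (c : R) (v : σ → R) : eval (c • v) f = c ^ n * eval v f := by
  rw [eval_eq, eval_eq, Finset.mul_sum]
  refine Finset.sum_congr rfl fun d hd => ?_
  have hdeg : ∑ i ∈ d.support, d i = n := by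
    simpa [Finsupp.weight_apply, Finsupp.sum] using hf (mem_support_iff.1 hd)
  simp only [Pi.smul_apply, smul_eq_mul, mul_pow, Finset.prod_mul_distrib,
    Finset.prod_pow_eq_pow_sum, hdeg]
  ring

theorem eval_mulVec_homogeneousCoords [Fintype K] [DecidableEq K] (hn : n + 1 = Fintype.card K)
    (g : GL (Fin 2) K) (f : homogeneousSubmodule (Fin 2) K n) (x : OnePoint K) :
    eval (g.1 *ᵥ homogeneousCoords x) f.1 = eval (homogeneousCoords (g • x)) f.1 := by
  obtain ⟨c, hc, h⟩ := exists_mulVec_homogeneousCoords g x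
  have hcn : c ^ n = 1 := by
    rw [← FiniteField.pow_card_sub_one_eq_one c hc, ← hn, Nat.add_sub_cancel]
  rw [h, eval_smul_of_isHomogeneous ((mem_homogeneousSubmodule n f.1).1 f.2), hcn, one_mul]

theorem sum_eval_eq_neg_coeff [Fintype K] (hn : n + 1 = Fintype.card K) {P : Polynomial K}
    (hP : P.natDegree ≤ n) : ∑ t, P.eval t = -P.coeff n := by
  have hlow (i : ℕ) (hi : i ∈ Finset.range n) : ∑ t : K, P.coeff i * t ^ i = 0 := by
    rw [← Finset.mul_sum, FiniteField.sum_pow_lt_card_sub_one K i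
      (by rw [← hn]; exact Finset.mem_range.1 hi), mul_zero]
  simp only [Polynomial.eval_eq_sum_range' (Nat.lt_succ_of_le hP)]
  rw [Finset.sum_comm, Finset.sum_range_succ, Finset.sum_eq_zero hlow, zero_add, ← Finset.mul_sum,
    sum_pow_eq_neg_one hn, mul_neg_one]

theorem eval_homogeneousCoords [Fintype K] (hn : n + 1 = Fintype.card K)
    (f : homogeneousSubmodule (Fin 2) K n) (x : OnePoint K) :
    eval (homogeneousCoords x) f.1 = sumZeroExtend K K (affineValues n f) x := by
  cases x
  · obtain ⟨P, hP, rfl⟩ := exists_binaryForm_eq f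
    simp only [eval_infty_binaryForm, sumZeroExtend_infty, affineValues_apply,
      eval_coe_binaryForm hP, sum_eval_eq_neg_coeff hn hP, neg_neg]
  · rfl

theorem affineValues_bijective [Fintype K] (hn : n + 1 = Fintype.card K) :
    Function.Bijective (affineValues (K := K) n) := by
  refine ⟨(injective_iff_map_eq_zero _).2 fun f hf => ?_, fun φ => ?_⟩
  · obtain ⟨P, hP, rfl⟩ := exists_binaryForm_eq f
    have hP0 : P = 0 := Polynomial.eq_zero_of_natDegree_lt_card_of_eval_eq_zero P
      Function.injective_id (fun t => (eval_coe_binaryForm hP t).symm.trans (congrFun hf t))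
      ((Nat.lt_succ_of_le hP).trans_eq hn)
    rw [hP0, map_zero]
  · classical
    have hinj : Set.InjOn (id : K → K) (Finset.univ : Finset K) := Function.injective_id.injOn
    have hP : (Lagrange.interpolate Finset.univ id φ).natDegree ≤ n :=
      Polynomial.natDegree_le_iff_coeff_eq_zero.2 fun i hi => Polynomial.coeff_eq_zero_of_degree_lt
        ((Lagrange.degree_interpolate_lt φ hinj).trans_le (Nat.cast_le.2 (hn.symm.trans_le hi)))
    refine ⟨binaryForm n (Lagrange.interpolate Finset.univ id φ), funext fun t => ?_⟩
    rw [affineValues_apply, eval_coe_binaryForm hP]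
    exact Lagrange.eval_interpolate_at_node φ hinj (Finset.mem_univ t)

theorem affineValues_homPolyRep [Fintype K] [DecidableEq K] (hn : n + 1 = Fintype.card K)
    (g : Matrix.SpecialLinearGroup (Fin 2) K) (f : homogeneousSubmodule (Fin 2) K n) :
    affineValues n (homPolyRep K K n g f) = sumZeroRep K g.toGL (affineValues n f) := by
  ext t
  have hinv := map_inv (Matrix.SpecialLinearGroup.toGL (R := K) (n := Fin 2)) g
  rw [affineValues_apply, eval_homPolyRep, sumZeroRep_apply, ← eval_homogeneousCoords hn, ← hinv]
  exact eval_mulVec_homogeneousCoords hn g⁻¹.toGL f t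

theorem liftsAlong_homPolyRep [Fintype K] (hn : n + 1 = Fintype.card K) {R : Type*} [CommRing R]
    (f : R →+* K) : LiftsAlong f (homPolyRep K K n) := by
  classical
  let E := LinearEquiv.ofBijective _ (affineValues_bijective hn)
  refine .of_basis (Module.Basis.ofEquivFun E)
    ((sumZeroRep R).comp Matrix.SpecialLinearGroup.toGL) fun g m => ?_
  apply E.injective
  have hE (m : K → R) : affineValues n (reductionMap f (Module.Basis.ofEquivFun E) m) = f ∘ m :=
    E.apply_symm_apply _
  refine .trans (hE _) (.trans ?_ (affineValues_homPolyRep hn g _).symm)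
  rw [hE]
  exact comp_sumZeroRep f _ m

end ProjectiveLine

theorem LiftsAlong.of_bijective_algebraMap {R k K G V : Type*} [CommRing R] [CommRing k]
    [CommRing K] [Algebra k K] [Monoid G] [AddCommGroup V] [Module k V] [Module K V]
    [IsScalarTower k K V] (hk : Function.Bijective (algebraMap k K)) {f : R →+* k}
    {ρ : Representation K G V} {ρ' : Representation k G V} (hρ : ∀ g v, ρ' g v = ρ g v)
    (hlift : LiftsAlong ((algebraMap k K).comp f) ρ) : LiftsAlong f ρ' := by
  obtain ⟨n, b, σ, hσ⟩ := hlift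
  let e := (RingEquiv.ofBijective _ hk).symm
  have he (c : K) (v : V) : e c • v = c • v := by
    obtain ⟨c, rfl⟩ := hk.2 c
    rw [algebraMap_smul]
    exact congrArg (· • v) (e.apply_symm_apply c)
  have hred (m : Fin n → R) :
      reductionMap f (b.mapCoeffs e he) m = reductionMap ((algebraMap k K).comp f) b m := by
    simp only [reductionMap_apply, Module.Basis.equivFun_symm_apply, Module.Basis.coe_mapCoeffs,
      Function.comp_apply, RingHom.comp_apply, algebraMap_smul]
  exact ⟨n, b.mapCoeffs e he, σ, fun g m => by rw [hred, hred, hρ, hσ]⟩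

theorem bijective_algebraMap_of_natCard_eq {p : ℕ} [Fact p.Prime] {K : Type*} [Field K]
    [Algebra (ZMod p) K] (hK : Nat.card K = p) : Function.Bijective (algebraMap (ZMod p) K) := by
  have : Finite K := Nat.finite_of_card_ne_zero (hK ▸ NeZero.ne p)
  have := Fintype.ofFinite K
  rw [Fintype.bijective_iff_injective_and_card, ZMod.card, ← Nat.card_eq_fintype_card, hK]
  exact ⟨(algebraMap (ZMod p) K).injective, rfl⟩

theorem liftsAlong_homPolyRep_of_natCard_eq {p : ℕ} [Fact p.Prime] {K : Type*} [Field K]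
    [Algebra (ZMod p) K] (hK : Nat.card K = p) {R : Type*} [CommRing R] (f : R →+* ZMod p) :
    LiftsAlong f (homPolyRep (ZMod p) K (p - 1)) := by
  have : Finite K := Nat.finite_of_card_ne_zero (hK ▸ NeZero.ne p)
  have := Fintype.ofFinite K
  have hn : p - 1 + 1 = Fintype.card K := by
    rw [← Nat.card_eq_fintype_card, hK, Nat.sub_add_cancel (Fact.out : p.Prime).one_le]
  exact .of_bijective_algebraMap (bijective_algebraMap_of_natCard_eq hK) (fun _ _ => rfl)
    (liftsAlong_homPolyRep hn ((algebraMap (ZMod p) K).comp f))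

theorem mainTheorem5_general (p : ℕ) [Fact p.Prime] (hp : p ≠ 2) (K : Type*) [Field K]
    [Algebra (ZMod p) K] :
    (LiftsToZModPow (homPolyRep (ZMod p) K (p - 1)) 2 two_ne_zero ↔ Nat.card K = p) ∧
      (Nat.card K = p → LiftsToPadic (homPolyRep (ZMod p) K (p - 1))) := by
  have hodd : Odd p := (Fact.out : p.Prime).odd_of_ne_two hp
  have := charP_of_injective_algebraMap (algebraMap (ZMod p) K).injective p
  refine ⟨⟨fun hlift => ?_, fun hK => ?_⟩, fun hK => ?_⟩
  · exact natCard_eq_of_forall_pow_sub_one_eq_one fun a ha =>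
      pow_sub_one_eq_one_of_liftsToZModPow hodd hlift ha
  · exact (liftsToZModPow_iff_liftsAlong two_ne_zero).2 (liftsAlong_homPolyRep_of_natCard_eq hK _)
  · exact (liftsAlong_homPolyRep_of_natCard_eq hK PadicInt.toZMod).liftsToPadic

theorem mainTheorem5 (p : ℕ) [Fact p.Prime] (hp : p ≠ 2) (r : ℕ)
    (K : Type*) [Field K] [Algebra (ZMod p) K] (hK : Nat.card K = p ^ r) :
    (LiftsToZModPow (homPolyRep (ZMod p) K (p - 1)) 2 two_ne_zero ↔ r = 1) ∧
      (r = 1 → LiftsToPadic (homPolyRep (ZMod p) K (p - 1))) := by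
  simpa only [hK, Nat.pow_eq_self_iff (Fact.out : p.Prime).one_lt] using
    mainTheorem5_general p hp K
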